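/- Let $N\ge 2$, let $u=u(x,t)$ be a scalar unknown and $U=(U_1,\dots,U_N)$ a vector unknown, and write $\langle \partial_x^mU,\partial_x^nU\rangle=\sum_{j=1}^N(\partial_x^mU_j)(\partial_x^nU_j)$. Consider a system with complex coefficients of the form $$u_t=a_1u_{xx}+a_2uu_x+a_3u^3+a_4u\langle U,U\rangle+a_5\langle U,U_x\rangle,$$ $$U_t=a_6U_{xx}+a_7u_xU+a_8uU_x+a_9u^2U+a_{10}\langle U,U\rangle U,$$ where $(a_1,a_6)\ne(0,0)$, $(a_4,a_5)\ne(0,0)$ and $(a_7,a_8,a_9)\neq(0,0,0)$. Suppose that it has a third-order symmetry of the form $$u_\tau=b_1u_{xxx}+b_2uu_{xx}+b_3u_x^2+b_4u^2u_x+b_5u^4+b_6u_x\langle U,U\rangle+b_7u\langle U,U_x\rangle+b_8\langle U,U_{xx}\rangle+b_9\langle U_x,U_x\rangle+b_{10}u^2\langle U,U\rangle+b_{11}\langle U,U\rangle^2,$$ $$U_\tau=b_{12}U_{xxx}+b_{13}u_{xx}U+b_{14}u_xU_x+b_{15}uU_{xx}+b_{16}uu_xU+b_{17}u^2U_x+b_{18}\langle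 U,U\rangle U_x+b_{19}\langle U,U_x\rangle U+b_{20}u^3U+b_{21}u\langle U,U\rangle U,$$ with complex $b_i$ such that $(b_1,b_{12})\ne(0,0)$, at least one of $b_1,\dots,b_{11}$ is nonzero and at least one of $b_{12},\dots,b_{21}$ is nonzero; that is, $(u_t)_\tau=(u_\tau)_t$ and $(U_t)_\tau=(U_\tau)_t$ hold identically as differential polynomials. Then, up to a scaling of $t,x,u,U$ (each multiplied by a nonzero complex constant), the system coincides with one of the following three systems: 1. for some $a\in\mathbb C$, $u_t=\frac13(1+2a)(u_{xx}+2uu_x)+\frac43\langle U,U_x\rangle$, $\;U_t=U_{xx}+\frac13(1-a)u_xU+uU_x+\frac1{12}(1-4a)u^2U-\frac13\langle U,U\rangle U$; 2. $u_t=u_{xx}+2uu_x+2\langle U,U_x\rangle$, $\;U_t=-\frac12u_xU-\frac12u^2U-\frac12\langle U,U\rangle U$; 3. $u_t=u_{xx}+2uu_x+\langle U,U_x\rangle$, $\;U_t=\frac12u_xU+uU_x$. -/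

import Mathlib

open MvPolynomial

noncomputable section

/-- Differential polynomials over the complex numbers in one scalar unknown `u` and a vector
unknown `U = (U_1, ..., U_N)`. The variable `(none, n)` is the `n`-th `x`-derivative of `u`,
and `(some j, n)` is the `n`-th `x`-derivative of the component `U_j`. -/
abbrev DiffPoly (N : ℕ) : Type := MvPolynomial (Option (Fin N) × ℕ) ℂ

/-- The right-hand sides of an evolutionary system: the entry at `none` is the right-hand side of
the equation for `u`, the entry at `some j` that of the equation for `U_j`. -/
abbrev EvolSystem (N : ℕ) : Type := Option (Fin N) → DiffPoly N

/-- The total `x`-derivative: the derivation that raises the order of every jet variable by 1. -/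
def totalDeriv (N : ℕ) : Derivation ℂ (DiffPoly N) (DiffPoly N) :=
  mkDerivation ℂ fun v => X (v.1, v.2 + 1)

/-- The derivative of a differential polynomial along the solutions of the system `F`: the
derivation that sends the `n`-th `x`-derivative of an unknown to the `n`-th total `x`-derivative
of the right-hand side of its equation. -/
def timeDeriv {N : ℕ} (F : EvolSystem N) : Derivation ℂ (DiffPoly N) (DiffPoly N) :=
  mkDerivation ℂ fun v => (totalDeriv N)^[v.2] (F v.1)

/-- The evolutionary system `G` (with time `τ`) is a symmetry of the evolutionary system `F`
(with time `t`): the mixed derivatives of all unknowns in `t` and `τ` agree. -/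
def IsSymmetry {N : ℕ} (F G : EvolSystem N) : Prop :=
  ∀ c, timeDeriv G (F c) = timeDeriv F (G c)

/-- The `n`-th `x`-derivative of `u`. -/
def uD {N : ℕ} (n : ℕ) : DiffPoly N := X (none, n)

/-- The `n`-th `x`-derivative of `U_j`. -/
def vD {N : ℕ} (j : Fin N) (n : ℕ) : DiffPoly N := X (some j, n)

/-- The scalar product of the `m`-th and the `n`-th `x`-derivative of `U`. -/
def sProd {N : ℕ} (m n : ℕ) : DiffPoly N := ∑ j, vD j m * vD j n

/-- The general homogeneous system of order 2 and weights `(1, 1)`; only the values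
`a 1, ..., a 10` occur. -/
def generalSystem2 (N : ℕ) (a : ℕ → ℂ) : EvolSystem N
  | none =>
      C (a 1) * uD 2 + C (a 2) * uD 0 * uD 1 + C (a 3) * uD 0 ^ 3
        + C (a 4) * uD 0 * sProd 0 0 + C (a 5) * sProd 0 1
  | some j =>
      C (a 6) * vD j 2 + C (a 7) * uD 1 * vD j 0 + C (a 8) * uD 0 * vD j 1
        + C (a 9) * uD 0 ^ 2 * vD j 0 + C (a 10) * sProd 0 0 * vD j 0

/-- The general homogeneous system of order 3 and weights `(1, 1)`; only the values
`b 1, ..., b 21` occur. -/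
def generalSystem3 (N : ℕ) (b : ℕ → ℂ) : EvolSystem N
  | none =>
      C (b 1) * uD 3 + C (b 2) * uD 0 * uD 2 + C (b 3) * uD 1 ^ 2
        + C (b 4) * uD 0 ^ 2 * uD 1 + C (b 5) * uD 0 ^ 4
        + C (b 6) * uD 1 * sProd 0 0 + C (b 7) * uD 0 * sProd 0 1
        + C (b 8) * sProd 0 2 + C (b 9) * sProd 1 1
        + C (b 10) * uD 0 ^ 2 * sProd 0 0 + C (b 11) * sProd 0 0 ^ 2
  | some j =>
      C (b 12) * vD j 3 + C (b 13) * uD 2 * vD j 0 + C (b 14) * uD 1 * vD j 1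
        + C (b 15) * uD 0 * vD j 2 + C (b 16) * uD 0 * uD 1 * vD j 0
        + C (b 17) * uD 0 ^ 2 * vD j 1 + C (b 18) * sProd 0 0 * vD j 1
        + C (b 19) * sProd 0 1 * vD j 0 + C (b 20) * uD 0 ^ 3 * vD j 0
        + C (b 21) * uD 0 * sProd 0 0 * vD j 0

/-- The constraints on the coefficients of `generalSystem2`: the order is 2 and the system is
truly coupled. -/
def IsCoupledSecondOrder (a : ℕ → ℂ) : Prop :=
  (a 1 ≠ 0 ∨ a 6 ≠ 0) ∧ (a 4 ≠ 0 ∨ a 5 ≠ 0) ∧ (a 7 ≠ 0 ∨ a 8 ≠ 0 ∨ a 9 ≠ 0)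

/-- The constraints on the coefficients of `generalSystem3` as a symmetry: the order is 3 and
neither of the two right-hand sides vanishes. -/
def IsThirdOrder (b : ℕ → ℂ) : Prop :=
  (b 1 ≠ 0 ∨ b 12 ≠ 0) ∧ (∃ i ∈ Finset.Icc 1 11, b i ≠ 0) ∧ (∃ i ∈ Finset.Icc 12 21, b i ≠ 0)

/-- The first Burgers-type system, with its free parameter `p`. -/
def burgersSystem1 (N : ℕ) (p : ℂ) : EvolSystem N
  | none =>
      C (1 / 3 * (1 + 2 * p)) * (uD 2 + 2 * uD 0 * uD 1) + C (4 / 3) * sProd 0 1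
  | some j =>
      vD j 2 + C (1 / 3 * (1 - p)) * uD 1 * vD j 0 + uD 0 * vD j 1
        + C (1 / 12 * (1 - 4 * p)) * uD 0 ^ 2 * vD j 0 - C (1 / 3) * sProd 0 0 * vD j 0

/-- The second Burgers-type system. -/
def burgersSystem2 (N : ℕ) : EvolSystem N
  | none => uD 2 + 2 * uD 0 * uD 1 + 2 * sProd 0 1
  | some j =>
      - C (1 / 2) * uD 1 * vD j 0 - C (1 / 2) * uD 0 ^ 2 * vD j 0
        - C (1 / 2) * sProd 0 0 * vD j 0

/-- The third Burgers-type system. -/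
def burgersSystem3 (N : ℕ) : EvolSystem N
  | none => uD 2 + 2 * uD 0 * uD 1 + sProd 0 1
  | some j => C (1 / 2) * uD 1 * vD j 0 + uD 0 * vD j 1

/-- The weight of an unknown under the scaling of `u` by `γ` and of `U` by `δ`. -/
def scaleFactor {N : ℕ} (γ δ : ℂ) : Option (Fin N) → ℂ
  | none => γ
  | some _ => δ

/-- The system satisfied by `γ * u`, `δ * U` as functions of `β * x`, `α * t` when `u`, `U`
satisfy the system `F`: with new unknowns `w`, the `n`-th `x`-derivative of an old unknown is
`β ^ n / γ` (or `β ^ n / δ`) times the `n`-th derivative of the new one, and the new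
time derivative is `γ / α` (or `δ / α`) times the old one. -/
def rescale {N : ℕ} (α β γ δ : ℂ) (F : EvolSystem N) : EvolSystem N := fun c =>
  C (scaleFactor γ δ c / α) *
    aeval (fun v : Option (Fin N) × ℕ =>
      (C (β ^ v.2 / scaleFactor γ δ v.1) * X v : DiffPoly N)) (F c)

/-- Two systems coincide up to a scaling of `t`, `x`, `u`, `U`. -/
def CoincideUpToScaling {N : ℕ} (F G : EvolSystem N) : Prop :=
  ∃ α β γ δ : ℂ, α ≠ 0 ∧ β ≠ 0 ∧ γ ≠ 0 ∧ δ ≠ 0 ∧ rescale α β γ δ F = G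

end

/-! Both flows are polynomial, so commutativity is the vanishing of a differential polynomial. Its
coefficients are bilinear in the `a i` and `b i`. Two independent components of `U` already separate
all its monomials, which is where `2 ≤ N` enters, so `symmetryRelations` turns the symmetry into a
finite list of bilinear equations. The rest is elimination of the `b i`.

The cubic terms `a 3` and `a 4` are excluded first, so `a 5 ≠ 0`. The relations `scalar_s04`,
`scalar_s13`, `scalar_s22` are then linear in `b 8`, `b 9`, `a 5 * b 1`, with determinant `-4 * a 6
^ 2` and right-hand sides proportional to `a 5 * b 12`. Hence there are two regimes. If `b 12 ≠ 0`,
then `a 6 ≠ 0` and all coefficients are governed by `a 1`, `a 5`, `a 6`, `a 8`: a family with the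
single invariant `a 1 / a 6` (`of_b12_ne_zero`). If `b 12 = 0`, then `a 6 = 0`, and `a 8 * (a 2 - 2
* a 8) = 0` separates the two isolated systems (`of_b12_eq_zero`). Scalings normalize what remains;
the square root needed for `U` exists over `ℂ`. -/

section

variable {N : ℕ}

/-! ### Rules for the total and the time derivative -/

theorem totalDeriv_C (c : ℂ) : totalDeriv N (C c) = 0 := (totalDeriv N).map_algebraMap c

theorem totalDeriv_uD (n : ℕ) : totalDeriv N (uD n) = uD (n + 1) := by
  simp [totalDeriv, uD]

theorem totalDeriv_vD (j : Fin N) (n : ℕ) : totalDeriv N (vD j n) = vD j (n + 1) := by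
  simp [totalDeriv, vD]

theorem totalDeriv_sProd (m n : ℕ) :
    totalDeriv N (sProd m n) = sProd (m + 1) n + sProd m (n + 1) := by
  simp only [sProd, map_sum, Derivation.leibniz, totalDeriv_vD, smul_eq_mul,
    Finset.sum_add_distrib]
  rw [add_comm]
  simp only [mul_comm]

theorem timeDeriv_C (F : EvolSystem N) (c : ℂ) : timeDeriv F (C c) = 0 :=
  (timeDeriv F).map_algebraMap c

theorem timeDeriv_uD (F : EvolSystem N) (n : ℕ) :
    timeDeriv F (uD n) = (totalDeriv N)^[n] (F none) := by
  simp [timeDeriv, uD]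

theorem timeDeriv_vD (F : EvolSystem N) (j : Fin N) (n : ℕ) :
    timeDeriv F (vD j n) = (totalDeriv N)^[n] (F (some j)) := by
  simp [timeDeriv, vD]

theorem timeDeriv_sProd (F : EvolSystem N) (m n : ℕ) :
    timeDeriv F (sProd m n) = ∑ j, (totalDeriv N)^[m] (F (some j)) * vD j n
      + ∑ j, (totalDeriv N)^[n] (F (some j)) * vD j m := by
  simp only [sProd, map_sum, Derivation.leibniz, timeDeriv_vD, smul_eq_mul,
    ← Finset.sum_add_distrib]
  exact Finset.sum_congr rfl fun j _ => by ring

/-! ### The commutativity defect on two-component jets -/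

/-- Evaluation of differential polynomials at a jet in which only the components `i` and `j` of
the vector unknown are nonzero. -/
noncomputable def jetEval (i j : Fin N) (u v w : ℕ → ℂ) : DiffPoly N →ₐ[ℂ] ℂ :=
  aeval fun x => x.1.elim (u x.2) fun k => if k = i then v x.2 else if k = j then w x.2 else 0

theorem jetEval_C (i j : Fin N) (u v w : ℕ → ℂ) (c : ℂ) : jetEval i j u v w (C c) = c :=
  (jetEval i j u v w).commutes c

theorem jetEval_uD (i j : Fin N) (u v w : ℕ → ℂ) (n : ℕ) : jetEval i j u v w (uD n) = u n := by
  simp [jetEval, uD]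

theorem jetEval_vD_left (i j : Fin N) (u v w : ℕ → ℂ) (n : ℕ) :
    jetEval i j u v w (vD i n) = v n := by
  simp [jetEval, vD]

theorem jetEval_vD_right {i j : Fin N} (hij : i ≠ j) (u v w : ℕ → ℂ) (n : ℕ) :
    jetEval i j u v w (vD j n) = w n := by
  simp [jetEval, vD, hij.symm]

/-- Sums of this shape come from `timeDeriv_sProd`; reducing them to two terms makes the evaluated
identities independent of `N`. -/
theorem jetEval_sum {i j : Fin N} (hij : i ≠ j) (u v w : ℕ → ℂ) (p : Fin N → DiffPoly N) (n : ℕ) :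
    jetEval i j u v w (∑ k, p k * vD k n) =
      jetEval i j u v w (p i) * v n + jetEval i j u v w (p j) * w n := by
  rw [map_sum, Finset.sum_eq_add_of_mem i j (Finset.mem_univ _) (Finset.mem_univ _) hij,
    map_mul, map_mul, jetEval_vD_left, jetEval_vD_right hij]
  intro k _ hk
  simp [jetEval, vD, hk.1, hk.2]

theorem jetEval_sProd {i j : Fin N} (hij : i ≠ j) (u v w : ℕ → ℂ) (m n : ℕ) :
    jetEval i j u v w (sProd m n) = v m * v n + w m * w n := by
  rw [sProd, jetEval_sum hij, jetEval_vD_left, jetEval_vD_right hij]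

set_option maxRecDepth 100000 in
set_option maxHeartbeats 4000000 in
-- The defect is collected by monomials in scalar products and derivatives, so each bracket is one
-- of the relations sought. The fifth-order terms cancel identically.
theorem jetEval_symmetry_vector {i j : Fin N} (hij : i ≠ j) {a b : ℕ → ℂ}
    (h : IsSymmetry (generalSystem2 N a) (generalSystem3 N b)) (u v w : ℕ → ℂ) :
    (-a 1 * b 13 + a 6 * b 13 + a 7 * b 1 - a 7 * b 12) * (v 0 * u 4)
      + (-a 1 * b 14 + 2 * a 6 * b 13 + a 6 * b 14 - 3 * a 7 * b 12 + a 8 * b 1 - a 8 * b 12) *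
          (v 1 * u 3)
      + (-a 1 * b 15 + 2 * a 6 * b 14 + a 6 * b 15 - 3 * a 7 * b 12 - 3 * a 8 * b 12) * (v 2 * u 2)
      + (2 * a 6 * b 15 - 3 * a 8 * b 12) * (v 3 * u 1)
      + (-a 5 * b 13 + a 7 * b 8) * (v 0 * (v 0 * v 3 + w 0 * w 3))
      + (-3 * a 5 * b 13 + 2 * a 6 * b 19 + a 7 * b 8 + 2 * a 7 * b 9 - 6 * a 10 * b 12) * (v 0 *
          (v 1 * v 2 + w 1 * w 2))
      + (-a 1 * b 16 - a 2 * b 13 + a 6 * b 16 + a 7 * b 2 - a 7 * b 15 + a 8 * b 13 + 2 * a 9 *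
          b 1 - 2 * a 9 * b 12) * (v 0 * u 0 * u 3)
      + (-a 1 * b 16 - 3 * a 2 * b 13 + 3 * a 6 * b 16 + a 7 * b 2 + 2 * a 7 * b 3 - a 7 * b 14 -
          6 * a 9 * b 12) * (v 0 * u 1 * u 2)
      + (-a 5 * b 14 + 2 * a 6 * b 19 + a 8 * b 8 - 6 * a 10 * b 12) * (v 1 * (v 0 * v 2 + w 0 *
          w 2))
      + (-a 5 * b 14 + 2 * a 6 * b 18 + 2 * a 6 * b 19 + a 8 * b 9 - 6 * a 10 * b 12) * (v 1 *
          (v 1 * v 1 + w 1 * w 1))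
      + (-2 * a 1 * b 17 - a 2 * b 14 + 2 * a 6 * b 16 + 2 * a 6 * b 17 - 2 * a 7 * b 15 + a 8 *
          b 2 + a 8 * b 14 - a 8 * b 15 - 6 * a 9 * b 12) * (v 1 * u 0 * u 2)
      + (-a 2 * b 14 + 2 * a 6 * b 16 + 2 * a 6 * b 17 + a 8 * b 3 - a 8 * b 14 - 6 * a 9 * b 12)
          * (v 1 * u 1 * u 1)
      + (-a 5 * b 15 + 4 * a 6 * b 18 - 6 * a 10 * b 12) * (v 2 * (v 0 * v 1 + w 0 * w 1))
      + (-a 2 * b 15 + 4 * a 6 * b 17 - a 8 * b 15 - 6 * a 9 * b 12) * (v 2 * u 0 * u 1)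
      + (-a 1 * b 21 - a 4 * b 13 + a 6 * b 21 + a 7 * b 6 - a 7 * b 18 - a 7 * b 19 + 2 * a 10 *
          b 13) * (v 0 * (v 0 * v 0 + w 0 * w 0) * u 2)
      + (-4 * a 4 * b 13 - a 5 * b 16 + 4 * a 6 * b 21 + 2 * a 7 * b 6 + a 7 * b 7 - 2 * a 7 *
          b 19 - a 8 * b 19) * (v 0 * (v 0 * v 1 + w 0 * w 1) * u 1)
      + (-2 * a 4 * b 13 - a 5 * b 16 + a 7 * b 7 + 2 * a 9 * b 8) * (v 0 * (v 0 * v 2 + w 0 *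
          w 2) * u 0)
      + (-2 * a 4 * b 13 - a 5 * b 16 + 2 * a 6 * b 21 + a 7 * b 7 + 2 * a 9 * b 9 - 2 * a 10 *
          b 15) * (v 0 * (v 1 * v 1 + w 1 * w 1) * u 0)
      + (-3 * a 1 * b 20 - a 2 * b 16 - 3 * a 3 * b 13 + 3 * a 6 * b 20 + a 7 * b 4 - a 7 * b 17 +
          a 8 * b 16 + 2 * a 9 * b 2 - 2 * a 9 * b 15) * (v 0 * u 0 * u 0 * u 2)
      + (-2 * a 2 * b 16 - 6 * a 3 * b 13 + 6 * a 6 * b 20 + 2 * a 7 * b 4 + a 8 * b 16 + 2 * a 9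
          * b 3 - 2 * a 9 * b 14 - 2 * a 9 * b 15) * (v 0 * u 0 * u 1 * u 1)
      + (-a 4 * b 14 + 2 * a 6 * b 21 - 2 * a 7 * b 18 + a 8 * b 6 - a 8 * b 18) * (v 1 * (v 0 *
          v 0 + w 0 * w 0) * u 1)
      + (-2 * a 4 * b 14 - 2 * a 5 * b 17 + 4 * a 6 * b 21 + a 8 * b 7 - 4 * a 10 * b 15) * (v 1 *
          (v 0 * v 1 + w 0 * w 1) * u 0)
      + (-2 * a 2 * b 17 - 3 * a 3 * b 14 + 6 * a 6 * b 20 + a 8 * b 4 + a 8 * b 17 - 4 * a 9 *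
          b 15) * (v 1 * u 0 * u 0 * u 1)
      + (-a 4 * b 15) * (v 2 * (v 0 * v 0 + w 0 * w 0) * u 0)
      + (-a 3 * b 15) * (v 2 * u 0 * u 0 * u 0)
      + (-a 5 * b 21 + 4 * a 7 * b 11 - 2 * a 10 * b 19) * (v 0 * (v 0 * v 0 + w 0 * w 0) * (v 0 *
          v 1 + w 0 * w 1))
      + (-a 2 * b 21 - 2 * a 4 * b 16 + 2 * a 7 * b 10 - 2 * a 7 * b 21 + a 8 * b 21 + 2 * a 9 *
          b 6 - 2 * a 9 * b 18 - 2 * a 9 * b 19 + 2 * a 10 * b 16) * (v 0 * (v 0 * v 0 + w 0 * w 0)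
          * u 0 * u 1)
      + (-2 * a 4 * b 16 - 3 * a 5 * b 20 + 2 * a 7 * b 10 + 2 * a 9 * b 7 - 2 * a 9 * b 19) *
          (v 0 * (v 0 * v 1 + w 0 * w 1) * u 0 * u 0)
      + (-3 * a 2 * b 20 - 4 * a 3 * b 16 + 4 * a 7 * b 5 + 3 * a 8 * b 20 + 2 * a 9 * b 4 - 2 *
          a 9 * b 17) * (v 0 * u 0 * u 0 * u 0 * u 1)
      + (a 8 * b 11 - 2 * a 10 * b 18) * (v 1 * (v 0 * v 0 + w 0 * w 0) * (v 0 * v 0 + w 0 * w 0))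
      + (-2 * a 4 * b 17 + a 8 * b 10 - 2 * a 9 * b 18) * (v 1 * (v 0 * v 0 + w 0 * w 0) * u 0 *
          u 0)
      + (-2 * a 3 * b 17 + a 8 * b 5) * (v 1 * u 0 * u 0 * u 0 * u 0)
      + (-a 4 * b 21 + 2 * a 9 * b 11) * (v 0 * (v 0 * v 0 + w 0 * w 0) * (v 0 * v 0 + w 0 * w 0)
          * u 0)
      + (-a 3 * b 21 - 3 * a 4 * b 20 + 2 * a 9 * b 10 - 2 * a 9 * b 21 + 2 * a 10 * b 20) * (v 0
          * (v 0 * v 0 + w 0 * w 0) * u 0 * u 0 * u 0)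
      + (-3 * a 3 * b 20 + 2 * a 9 * b 5) * (v 0 * u 0 * u 0 * u 0 * u 0 * u 0) = 0 := by
  have H := congrArg (jetEval i j u v w) (h (some i))
  simp only [generalSystem2, generalSystem3, pow_succ, pow_zero, one_mul, map_add,
    Derivation.leibniz, timeDeriv_C, timeDeriv_uD, timeDeriv_vD, timeDeriv_sProd,
    Function.iterate_succ, Function.iterate_zero, Function.comp_apply, id, smul_eq_mul,
    totalDeriv_C, totalDeriv_uD, totalDeriv_vD, totalDeriv_sProd, mul_zero, add_zero, zero_add,
    map_mul, jetEval_C, jetEval_uD, jetEval_vD_left, jetEval_vD_right hij, jetEval_sProd hij,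
    jetEval_sum hij] at H
  linear_combination H

set_option maxRecDepth 100000 in
set_option maxHeartbeats 4000000 in
theorem jetEval_symmetry_scalar {i j : Fin N} (hij : i ≠ j) {a b : ℕ → ℂ}
    (h : IsSymmetry (generalSystem2 N a) (generalSystem3 N b)) (u v w : ℕ → ℂ) :
    (a 1 * b 8 - a 5 * b 1 + a 5 * b 12 - a 6 * b 8) * ((v 0 * v 4 + w 0 * w 4))
      + (2 * a 1 * b 8 + 2 * a 1 * b 9 - 4 * a 5 * b 1 + a 5 * b 12 - 2 * a 6 * b 9) * ((v 1 * v 3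
          + w 1 * w 3))
      + (a 1 * b 8 + 2 * a 1 * b 9 - 3 * a 5 * b 1 - a 6 * b 8) * ((v 2 * v 2 + w 2 * w 2))
      + (2 * a 1 * b 2 - 3 * a 2 * b 1) * (u 1 * u 3)
      + (2 * a 1 * b 3 - 3 * a 2 * b 1) * (u 2 * u 2)
      + (a 5 * b 13 - a 7 * b 8) * ((v 0 * v 0 + w 0 * w 0) * u 3)
      + (4 * a 1 * b 6 - 6 * a 4 * b 1 - a 5 * b 2 + 2 * a 5 * b 13 + a 5 * b 14 - 2 * a 7 * b 8 -
          2 * a 7 * b 9 - a 8 * b 8) * ((v 0 * v 1 + w 0 * w 1) * u 2)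
      + (2 * a 1 * b 6 + 2 * a 1 * b 7 + a 2 * b 8 - 6 * a 4 * b 1 - 2 * a 5 * b 3 + a 5 * b 14 +
          a 5 * b 15 - 2 * a 6 * b 6 - 2 * a 7 * b 8 - 2 * a 8 * b 8) * ((v 0 * v 2 + w 0 * w 2) *
          u 1)
      + (a 1 * b 7 + a 2 * b 8 - 2 * a 4 * b 1 + 2 * a 4 * b 12 - a 5 * b 2 + a 5 * b 15 - a 6 *
          b 7 - a 8 * b 8) * ((v 0 * v 3 + w 0 * w 3) * u 0)
      + (2 * a 1 * b 6 + 2 * a 1 * b 7 + a 2 * b 9 - 6 * a 4 * b 1 - 2 * a 5 * b 3 + a 5 * b 14 -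
          2 * a 7 * b 9 - 2 * a 8 * b 9) * ((v 1 * v 1 + w 1 * w 1) * u 1)
      + (3 * a 1 * b 7 + a 2 * b 8 + 2 * a 2 * b 9 - 6 * a 4 * b 1 - 3 * a 5 * b 2 + a 5 * b 15 -
          a 6 * b 7 - a 8 * b 8 - 2 * a 8 * b 9) * ((v 1 * v 2 + w 1 * w 2) * u 0)
      + (4 * a 1 * b 4 - 2 * a 2 * b 2 - 18 * a 3 * b 1) * (u 0 * u 1 * u 2)
      + (2 * a 1 * b 4 - a 2 * b 3 - 6 * a 3 * b 1) * (u 1 * u 1 * u 1)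
      + (4 * a 1 * b 11 + a 4 * b 8 - a 5 * b 6 + a 5 * b 18 + a 5 * b 19 - 4 * a 6 * b 11 - 4 *
          a 10 * b 8) * ((v 0 * v 0 + w 0 * w 0) * (v 0 * v 2 + w 0 * w 2))
      + (4 * a 1 * b 11 + a 4 * b 9 - a 5 * b 6 + a 5 * b 18 + a 5 * b 19 - 2 * a 10 * b 8 - 2 *
          a 10 * b 9) * ((v 0 * v 0 + w 0 * w 0) * (v 1 * v 1 + w 1 * w 1))
      + (-a 4 * b 2 + 2 * a 4 * b 13 + a 5 * b 16 - a 7 * b 7 - 2 * a 9 * b 8) * ((v 0 * v 0 + w 0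
          * w 0) * u 0 * u 2)
      + (2 * a 1 * b 10 - a 4 * b 3 + a 5 * b 16 - 2 * a 7 * b 6 - 2 * a 9 * b 8) * ((v 0 * v 0 +
          w 0 * w 0) * u 1 * u 1)
      + (8 * a 1 * b 11 - a 5 * b 7 + 2 * a 5 * b 18 + 2 * a 5 * b 19 - 4 * a 10 * b 8 - 4 * a 10
          * b 9) * ((v 0 * v 1 + w 0 * w 1) * (v 0 * v 1 + w 0 * w 1))
      + (8 * a 1 * b 10 + 2 * a 2 * b 6 + a 2 * b 7 - 4 * a 4 * b 2 - 4 * a 4 * b 3 + 2 * a 4 *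
          b 14 - 2 * a 5 * b 4 + 2 * a 5 * b 16 + 2 * a 5 * b 17 - 2 * a 7 * b 7 - 2 * a 8 * b 6 -
          a 8 * b 7 - 4 * a 9 * b 8 - 4 * a 9 * b 9) * ((v 0 * v 1 + w 0 * w 1) * u 0 * u 1)
      + (2 * a 1 * b 10 + a 2 * b 7 + 3 * a 3 * b 8 - 2 * a 4 * b 2 + 2 * a 4 * b 15 - a 5 * b 4 +
          a 5 * b 17 - 2 * a 6 * b 10 - a 8 * b 7 - 2 * a 9 * b 8) * ((v 0 * v 2 + w 0 * w 2) *
          u 0 * u 0)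
      + (2 * a 1 * b 10 + a 2 * b 7 + 3 * a 3 * b 9 - 2 * a 4 * b 2 - a 5 * b 4 + a 5 * b 17 - a 8
          * b 7 - 2 * a 9 * b 9) * ((v 1 * v 1 + w 1 * w 1) * u 0 * u 0)
      + (-a 3 * b 2) * (u 0 * u 0 * u 0 * u 2)
      + (12 * a 1 * b 5 - 6 * a 3 * b 2 - 3 * a 3 * b 3) * (u 0 * u 0 * u 1 * u 1)
      + (a 2 * b 11 + a 5 * b 21 - 4 * a 7 * b 11 - 2 * a 10 * b 6) * ((v 0 * v 0 + w 0 * w 0) *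
          (v 0 * v 0 + w 0 * w 0) * u 1)
      + (4 * a 2 * b 11 - 2 * a 4 * b 6 + 2 * a 4 * b 18 + 2 * a 4 * b 19 - 2 * a 5 * b 10 + 4 *
          a 5 * b 21 - 4 * a 8 * b 11 - 4 * a 10 * b 7) * ((v 0 * v 0 + w 0 * w 0) * (v 0 * v 1 +
          w 0 * w 1) * u 0)
      + (a 2 * b 10 - 2 * a 4 * b 4 + 2 * a 4 * b 16 + 3 * a 5 * b 20 - 2 * a 7 * b 10 - 2 * a 9 *
          b 6 - 2 * a 9 * b 7) * ((v 0 * v 0 + w 0 * w 0) * u 0 * u 0 * u 1)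
      + (2 * a 2 * b 10 + 2 * a 3 * b 7 - 2 * a 4 * b 4 + 2 * a 4 * b 17 - 4 * a 5 * b 5 + 2 * a 5
          * b 20 - 2 * a 8 * b 10 - 2 * a 9 * b 7) * ((v 0 * v 1 + w 0 * w 1) * u 0 * u 0 * u 0)
      + (a 2 * b 5 - 2 * a 3 * b 4) * (u 0 * u 0 * u 0 * u 0 * u 1)
      + (a 4 * b 11 - 4 * a 10 * b 11) * ((v 0 * v 0 + w 0 * w 0) * (v 0 * v 0 + w 0 * w 0) * (v 0
          * v 0 + w 0 * w 0))
      + (3 * a 3 * b 11 - a 4 * b 10 + 2 * a 4 * b 21 - 4 * a 9 * b 11 - 2 * a 10 * b 10) * ((v 0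
          * v 0 + w 0 * w 0) * (v 0 * v 0 + w 0 * w 0) * u 0 * u 0)
      + (a 3 * b 10 - 3 * a 4 * b 5 + 2 * a 4 * b 20 - 2 * a 9 * b 10) * ((v 0 * v 0 + w 0 * w 0)
          * u 0 * u 0 * u 0 * u 0)
      + (-a 3 * b 5) * (u 0 * u 0 * u 0 * u 0 * u 0 * u 0) = 0 := by
  have H := congrArg (jetEval i j u v w) (h (none))
  simp only [generalSystem2, generalSystem3, pow_succ, pow_zero, one_mul, map_add,
    Derivation.leibniz, timeDeriv_C, timeDeriv_uD, timeDeriv_sProd,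
    Function.iterate_succ, Function.iterate_zero, Function.comp_apply, id, smul_eq_mul,
    totalDeriv_C, totalDeriv_uD, totalDeriv_vD, totalDeriv_sProd, mul_zero, add_zero, zero_add,
    map_mul, jetEval_C, jetEval_uD, jetEval_vD_left, jetEval_vD_right hij, jetEval_sProd hij,
    jetEval_sum hij] at H
  linear_combination H

/-! ### Extraction of the coefficient relations -/

/-- The relations between the coefficients of a second-order system and a third-order symmetry:
the coefficients of the monomials, named by the fields, in the defect of commutativity. In these
names `s` stands for scalar products, and `U` for derivatives of the vector unknown. -/
structure SymmetryRelations (a b : ℕ → ℂ) : Prop where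
  scalar_s04 : a 1 * b 8 - a 5 * b 1 + a 5 * b 12 - a 6 * b 8 = 0
  scalar_s13 : 2 * a 1 * b 8 + 2 * a 1 * b 9 - 4 * a 5 * b 1 + a 5 * b 12 - 2 * a 6 * b 9 = 0
  scalar_s22 : a 1 * b 8 + 2 * a 1 * b 9 - 3 * a 5 * b 1 - a 6 * b 8 = 0
  scalar_u1_u3 : 2 * a 1 * b 2 - 3 * a 2 * b 1 = 0
  scalar_u2_pow2 : 2 * a 1 * b 3 - 3 * a 2 * b 1 = 0
  scalar_s00_u3 : a 5 * b 13 - a 7 * b 8 = 0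
  scalar_s01_u2 : 4 * a 1 * b 6 - 6 * a 4 * b 1 - a 5 * b 2 + 2 * a 5 * b 13 + a 5 * b 14 - 2 *
      a 7 * b 8 - 2 * a 7 * b 9 - a 8 * b 8 = 0
  scalar_s02_u1 : 2 * a 1 * b 6 + 2 * a 1 * b 7 + a 2 * b 8 - 6 * a 4 * b 1 - 2 * a 5 * b 3 + a 5
      * b 14 + a 5 * b 15 - 2 * a 6 * b 6 - 2 * a 7 * b 8 - 2 * a 8 * b 8 = 0
  scalar_s03_u0 : a 1 * b 7 + a 2 * b 8 - 2 * a 4 * b 1 + 2 * a 4 * b 12 - a 5 * b 2 + a 5 * b 15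
      - a 6 * b 7 - a 8 * b 8 = 0
  scalar_s11_u1 : 2 * a 1 * b 6 + 2 * a 1 * b 7 + a 2 * b 9 - 6 * a 4 * b 1 - 2 * a 5 * b 3 + a 5
      * b 14 - 2 * a 7 * b 9 - 2 * a 8 * b 9 = 0
  scalar_s12_u0 : 3 * a 1 * b 7 + a 2 * b 8 + 2 * a 2 * b 9 - 6 * a 4 * b 1 - 3 * a 5 * b 2 + a 5
      * b 15 - a 6 * b 7 - a 8 * b 8 - 2 * a 8 * b 9 = 0
  scalar_u0_u1_u2 : 4 * a 1 * b 4 - 2 * a 2 * b 2 - 18 * a 3 * b 1 = 0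
  scalar_u1_pow3 : 2 * a 1 * b 4 - a 2 * b 3 - 6 * a 3 * b 1 = 0
  scalar_s00_s02 : 4 * a 1 * b 11 + a 4 * b 8 - a 5 * b 6 + a 5 * b 18 + a 5 * b 19 - 4 * a 6 *
      b 11 - 4 * a 10 * b 8 = 0
  scalar_s00_s11 : 4 * a 1 * b 11 + a 4 * b 9 - a 5 * b 6 + a 5 * b 18 + a 5 * b 19 - 2 * a 10 *
      b 8 - 2 * a 10 * b 9 = 0
  scalar_s00_u0_u2 : -a 4 * b 2 + 2 * a 4 * b 13 + a 5 * b 16 - a 7 * b 7 - 2 * a 9 * b 8 = 0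
  scalar_s00_u1_pow2 : 2 * a 1 * b 10 - a 4 * b 3 + a 5 * b 16 - 2 * a 7 * b 6 - 2 * a 9 * b 8 = 0
  scalar_s01_pow2 : 8 * a 1 * b 11 - a 5 * b 7 + 2 * a 5 * b 18 + 2 * a 5 * b 19 - 4 * a 10 * b 8
      - 4 * a 10 * b 9 = 0
  scalar_s01_u0_u1 : 8 * a 1 * b 10 + 2 * a 2 * b 6 + a 2 * b 7 - 4 * a 4 * b 2 - 4 * a 4 * b 3 +
      2 * a 4 * b 14 - 2 * a 5 * b 4 + 2 * a 5 * b 16 + 2 * a 5 * b 17 - 2 * a 7 * b 7 - 2 * a 8 *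
      b 6 - a 8 * b 7 - 4 * a 9 * b 8 - 4 * a 9 * b 9 = 0
  scalar_s02_u0_pow2 : 2 * a 1 * b 10 + a 2 * b 7 + 3 * a 3 * b 8 - 2 * a 4 * b 2 + 2 * a 4 * b 15
      - a 5 * b 4 + a 5 * b 17 - 2 * a 6 * b 10 - a 8 * b 7 - 2 * a 9 * b 8 = 0
  scalar_s11_u0_pow2 : 2 * a 1 * b 10 + a 2 * b 7 + 3 * a 3 * b 9 - 2 * a 4 * b 2 - a 5 * b 4 +
      a 5 * b 17 - a 8 * b 7 - 2 * a 9 * b 9 = 0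
  scalar_u0_pow3_u2 : -a 3 * b 2 = 0
  scalar_u0_pow2_u1_pow2 : 12 * a 1 * b 5 - 6 * a 3 * b 2 - 3 * a 3 * b 3 = 0
  scalar_s00_pow2_u1 : a 2 * b 11 + a 5 * b 21 - 4 * a 7 * b 11 - 2 * a 10 * b 6 = 0
  scalar_s00_s01_u0 : 4 * a 2 * b 11 - 2 * a 4 * b 6 + 2 * a 4 * b 18 + 2 * a 4 * b 19 - 2 * a 5 *
      b 10 + 4 * a 5 * b 21 - 4 * a 8 * b 11 - 4 * a 10 * b 7 = 0
  scalar_s00_u0_pow2_u1 : a 2 * b 10 - 2 * a 4 * b 4 + 2 * a 4 * b 16 + 3 * a 5 * b 20 - 2 * a 7 *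
      b 10 - 2 * a 9 * b 6 - 2 * a 9 * b 7 = 0
  scalar_s01_u0_pow3 : 2 * a 2 * b 10 + 2 * a 3 * b 7 - 2 * a 4 * b 4 + 2 * a 4 * b 17 - 4 * a 5 *
      b 5 + 2 * a 5 * b 20 - 2 * a 8 * b 10 - 2 * a 9 * b 7 = 0
  scalar_u0_pow4_u1 : a 2 * b 5 - 2 * a 3 * b 4 = 0
  scalar_s00_pow3 : a 4 * b 11 - 4 * a 10 * b 11 = 0
  scalar_s00_pow2_u0_pow2 : 3 * a 3 * b 11 - a 4 * b 10 + 2 * a 4 * b 21 - 4 * a 9 * b 11 - 2 *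
      a 10 * b 10 = 0
  scalar_s00_u0_pow4 : a 3 * b 10 - 3 * a 4 * b 5 + 2 * a 4 * b 20 - 2 * a 9 * b 10 = 0
  scalar_u0_pow6 : -a 3 * b 5 = 0
  vector_U0_u4 : -a 1 * b 13 + a 6 * b 13 + a 7 * b 1 - a 7 * b 12 = 0
  vector_U1_u3 : -a 1 * b 14 + 2 * a 6 * b 13 + a 6 * b 14 - 3 * a 7 * b 12 + a 8 * b 1 - a 8 *
      b 12 = 0
  vector_U2_u2 : -a 1 * b 15 + 2 * a 6 * b 14 + a 6 * b 15 - 3 * a 7 * b 12 - 3 * a 8 * b 12 = 0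
  vector_U3_u1 : 2 * a 6 * b 15 - 3 * a 8 * b 12 = 0
  vector_U0_s03 : -a 5 * b 13 + a 7 * b 8 = 0
  vector_U0_s12 : -3 * a 5 * b 13 + 2 * a 6 * b 19 + a 7 * b 8 + 2 * a 7 * b 9 - 6 * a 10 * b 12 = 0
  vector_U0_u0_u3 : -a 1 * b 16 - a 2 * b 13 + a 6 * b 16 + a 7 * b 2 - a 7 * b 15 + a 8 * b 13 +
      2 * a 9 * b 1 - 2 * a 9 * b 12 = 0
  vector_U0_u1_u2 : -a 1 * b 16 - 3 * a 2 * b 13 + 3 * a 6 * b 16 + a 7 * b 2 + 2 * a 7 * b 3 -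
      a 7 * b 14 - 6 * a 9 * b 12 = 0
  vector_U1_s02 : -a 5 * b 14 + 2 * a 6 * b 19 + a 8 * b 8 - 6 * a 10 * b 12 = 0
  vector_U1_s11 : -a 5 * b 14 + 2 * a 6 * b 18 + 2 * a 6 * b 19 + a 8 * b 9 - 6 * a 10 * b 12 = 0
  vector_U1_u0_u2 : -2 * a 1 * b 17 - a 2 * b 14 + 2 * a 6 * b 16 + 2 * a 6 * b 17 - 2 * a 7 *
      b 15 + a 8 * b 2 + a 8 * b 14 - a 8 * b 15 - 6 * a 9 * b 12 = 0
  vector_U1_u1_pow2 : -a 2 * b 14 + 2 * a 6 * b 16 + 2 * a 6 * b 17 + a 8 * b 3 - a 8 * b 14 - 6 *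
      a 9 * b 12 = 0
  vector_U2_s01 : -a 5 * b 15 + 4 * a 6 * b 18 - 6 * a 10 * b 12 = 0
  vector_U2_u0_u1 : -a 2 * b 15 + 4 * a 6 * b 17 - a 8 * b 15 - 6 * a 9 * b 12 = 0
  vector_U0_s00_u2 : -a 1 * b 21 - a 4 * b 13 + a 6 * b 21 + a 7 * b 6 - a 7 * b 18 - a 7 * b 19 +
      2 * a 10 * b 13 = 0
  vector_U0_s01_u1 : -4 * a 4 * b 13 - a 5 * b 16 + 4 * a 6 * b 21 + 2 * a 7 * b 6 + a 7 * b 7 - 2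
      * a 7 * b 19 - a 8 * b 19 = 0
  vector_U0_s02_u0 : -2 * a 4 * b 13 - a 5 * b 16 + a 7 * b 7 + 2 * a 9 * b 8 = 0
  vector_U0_s11_u0 : -2 * a 4 * b 13 - a 5 * b 16 + 2 * a 6 * b 21 + a 7 * b 7 + 2 * a 9 * b 9 - 2
      * a 10 * b 15 = 0
  vector_U0_u0_pow2_u2 : -3 * a 1 * b 20 - a 2 * b 16 - 3 * a 3 * b 13 + 3 * a 6 * b 20 + a 7 *
      b 4 - a 7 * b 17 + a 8 * b 16 + 2 * a 9 * b 2 - 2 * a 9 * b 15 = 0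
  vector_U0_u0_u1_pow2 : -2 * a 2 * b 16 - 6 * a 3 * b 13 + 6 * a 6 * b 20 + 2 * a 7 * b 4 + a 8 *
      b 16 + 2 * a 9 * b 3 - 2 * a 9 * b 14 - 2 * a 9 * b 15 = 0
  vector_U1_s00_u1 : -a 4 * b 14 + 2 * a 6 * b 21 - 2 * a 7 * b 18 + a 8 * b 6 - a 8 * b 18 = 0
  vector_U1_s01_u0 : -2 * a 4 * b 14 - 2 * a 5 * b 17 + 4 * a 6 * b 21 + a 8 * b 7 - 4 * a 10 *
      b 15 = 0
  vector_U1_u0_pow2_u1 : -2 * a 2 * b 17 - 3 * a 3 * b 14 + 6 * a 6 * b 20 + a 8 * b 4 + a 8 *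
      b 17 - 4 * a 9 * b 15 = 0
  vector_U2_s00_u0 : -a 4 * b 15 = 0
  vector_U2_u0_pow3 : -a 3 * b 15 = 0
  vector_U0_s00_s01 : -a 5 * b 21 + 4 * a 7 * b 11 - 2 * a 10 * b 19 = 0
  vector_U0_s00_u0_u1 : -a 2 * b 21 - 2 * a 4 * b 16 + 2 * a 7 * b 10 - 2 * a 7 * b 21 + a 8 *
      b 21 + 2 * a 9 * b 6 - 2 * a 9 * b 18 - 2 * a 9 * b 19 + 2 * a 10 * b 16 = 0
  vector_U0_s01_u0_pow2 : -2 * a 4 * b 16 - 3 * a 5 * b 20 + 2 * a 7 * b 10 + 2 * a 9 * b 7 - 2 *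
      a 9 * b 19 = 0
  vector_U0_u0_pow3_u1 : -3 * a 2 * b 20 - 4 * a 3 * b 16 + 4 * a 7 * b 5 + 3 * a 8 * b 20 + 2 *
      a 9 * b 4 - 2 * a 9 * b 17 = 0
  vector_U1_s00_pow2 : a 8 * b 11 - 2 * a 10 * b 18 = 0
  vector_U1_s00_u0_pow2 : -2 * a 4 * b 17 + a 8 * b 10 - 2 * a 9 * b 18 = 0
  vector_U1_u0_pow4 : -2 * a 3 * b 17 + a 8 * b 5 = 0
  vector_U0_s00_pow2_u0 : -a 4 * b 21 + 2 * a 9 * b 11 = 0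
  vector_U0_s00_u0_pow3 : -a 3 * b 21 - 3 * a 4 * b 20 + 2 * a 9 * b 10 - 2 * a 9 * b 21 + 2 *
      a 10 * b 20 = 0
  vector_U0_u0_pow5 : -3 * a 3 * b 20 + 2 * a 9 * b 5 = 0

/-- The jet with the given initial entries and zeros after them. -/
def listJet (l : List ℂ) (n : ℕ) : ℂ := l.getD n 0

set_option maxHeartbeats 4000000 in
theorem symmetryRelations {a b : ℕ → ℂ} (hN : 2 ≤ N)
    (h : IsSymmetry (generalSystem2 N a) (generalSystem3 N b)) : SymmetryRelations a b := by
  -- With one component, monomials such as `⟨U,U⟩⟨U_x,U_x⟩` and `⟨U,U_x⟩²` would coincide.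
  have hij : (⟨0, by omega⟩ : Fin N) ≠ ⟨1, by omega⟩ := by simp
  have S (u v w : List ℂ) := jetEval_symmetry_scalar hij h (listJet u) (listJet v) (listJet w)
  have V (u v w : List ℂ) := jetEval_symmetry_vector hij h (listJet u) (listJet v) (listJet w)
  -- For each relation, a combination of evaluations at small integer jets cancels every monomial
  -- except the named one and gives that one weight 1. Normalization is postponed until the list
  -- entries have been read off.
  constructor
  case' scalar_s04 =>
    linear_combination (norm := skip) -S [] [1, 0, 0, 0, -1] [1, 0, 0, 0, -1] +
        S [] [-1] [1, 0, 0, 0, -1]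
  case' scalar_s13 =>
    linear_combination (norm := skip) S [] [0, -1, 0, -1] []
  case' scalar_s22 =>
    linear_combination (norm := skip) 1/4 * S [] [] [0, 0, 2]
  case' scalar_u1_u3 =>
    linear_combination (norm := skip) S [0, -1, 0, 1] [] [] - S [0, -1, 0, 2] [] []
  case' scalar_u2_pow2 =>
    linear_combination (norm := skip) 1/4 * S [0, 0, 2] [] []
  case' scalar_s00_u3 =>
    linear_combination (norm := skip) -S [0, 0, 0, 1] [-1] [] + S [0, 0, 0, 2] [-1] []
  case' scalar_s01_u2 =>
    linear_combination (norm := skip) 1/2 * S [0, 0, 1] [0, 1] [-1, -1] - 1/2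
        * S [0, 0, -1] [-1, -1] [0, 1]
  case' scalar_s02_u1 =>
    linear_combination (norm := skip) -1/18 * S [0, 2] [1, 0, -1] [2, 0, -1] + 1/18
        * S [0, 2] [1, 0, -1] [2, 0, 1] + 5/18 * S [0, -1] [1, 0, -1] [-1] - 5/18
        * S [0, -1] [-1, 0, -1] [-1]
  case' scalar_s03_u0 =>
    linear_combination (norm := skip) -S [1] [1] [2, 0, 0, 2] + S [1] [1, 0, 0, 1] [2, 0, 0, 2]
  case' scalar_s11_u1 =>
    linear_combination (norm := skip) S [0, 1] [0, -1] [] - S [0, 1] [] []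
  case' scalar_s12_u0 =>
    linear_combination (norm := skip) -1/2 * S [-1] [0, 1, 1] [0, 1, 1] + 1/2
        * S [1] [0, -1, -1] [0, -1, 1]
  case' scalar_u0_u1_u2 =>
    linear_combination (norm := skip) -S [-1, 2, 2] [] [] + S [-1, 1, 2] [] [] -
        S [-1, 1, 1] [] [] + S [1, 2, -1] [] []
  case' scalar_u1_pow3 =>
    linear_combination (norm := skip) S [0, 1] [] []
  case' scalar_s00_s02 =>
    linear_combination (norm := skip) 1/2 * S [] [0, 0, 1] [1, 0, 1] - 1/2
        * S [] [0, 0, -1] [1, 0, -1]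
  case' scalar_s00_s11 =>
    linear_combination (norm := skip) S [] [1] [0, 1] - S [] [-1] []
  case' scalar_s00_u0_u2 =>
    linear_combination (norm := skip) -1/2 * S [1, 0, -1] [] [1] - 1/2 * S [-1, 0, -1] [] [] + 1/2
        * S [-1, 0, 1] [] [] + 1/2 * S [1, 0, 1] [] [1]
  case' scalar_s00_u1_pow2 =>
    linear_combination (norm := skip) -1/6 * S [0, -1] [1] [-1] - 1/2 * S [0, -1] [] [] +
        S [0, -1] [1] [] + 1/3 * S [0, 1] [] [1]
  case' scalar_s01_pow2 =>
    linear_combination (norm := skip) S [] [1, -1] [] - S [] [1] [0, 1]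
  case' scalar_s01_u0_u1 =>
    linear_combination (norm := skip) -1/6 * S [-1, 2] [1, 1] [1, 2] + 1/6
        * S [1, 2] [1, 1] [1, 2] + 1/4 * S [1, 1] [1] [-1, 2] - 1/4 * S [1, 1] [1] [1, 2]
  case' scalar_s02_u0_pow2 =>
    linear_combination (norm := skip) -1/3 * S [2] [0, 0, 1] [-1, 0, -1] + 1/3
        * S [-1] [] [-1, 0, 1] - 1/3 * S [-1] [1] [0, 0, 2] + 1/3 * S [2] [0, 0, 1] [1, 0, 2]
  case' scalar_s11_u0_pow2 =>
    linear_combination (norm := skip) S [-1] [0, -1] [] - S [-1] [] []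
  case' scalar_u0_pow3_u2 =>
    linear_combination (norm := skip) 1/2 * S [-1, 0, -1] [] [] - 1/2 * S [1, 0, -1] [] []
  case' scalar_u0_pow2_u1_pow2 =>
    linear_combination (norm := skip) 7/18 * S [1, -1] [] [] + 3/2 * S [-1, 1] [] [] - 1/36
        * S [2, 2] [] [] - 1/9 * S [1, 2] [] []
  case' scalar_s00_pow2_u1 =>
    linear_combination (norm := skip) S [0, -1] [] [] - 1/2 * S [0, -1] [1] [] + 1/2
        * S [0, 1] [] [1]
  case' scalar_s00_s01_u0 =>
    linear_combination (norm := skip) -1/2 * S [-1] [0, -1] [1, 2] - 1/24 * S [2] [-1, -1] [1, 2]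
        + 1/2 * S [-1] [0, 1] [-1, 2] + 1/24 * S [2] [1, -1] [-1, 2]
  case' scalar_s00_u0_pow2_u1 =>
    linear_combination (norm := skip) -5/32 * S [2, 1] [] [] + 5/32 * S [2, -1] [] [] - 1/96
        * S [2, 1] [] [2] + 1/6 * S [2, 1] [] [-1] + 1/96 * S [2, -1] [] [2] - 1/6
        * S [2, -1] [1] []
  case' scalar_s01_u0_pow3 =>
    linear_combination (norm := skip) -5/8 * S [-1] [-1, -1] [] + 1/8 * S [-1] [1, 1] [2] + 5/8
        * S [-1] [-1, 1] [] - 1/8 * S [-1] [1, -1] [2]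
  case' scalar_u0_pow4_u1 =>
    linear_combination (norm := skip) -7/30 * S [1, -1] [] [] - 5/6 * S [-1, 1] [] [] - 1/15
        * S [2, 1] [] [] + 1/12 * S [2, 2] [] []
  case' scalar_s00_pow3 =>
    linear_combination (norm := skip) 1/8 * S [] [-1] [1]
  case' scalar_s00_pow2_u0_pow2 =>
    linear_combination (norm := skip) -1/4 * S [1] [1] [2] + 1/2 * S [-1] [] [] + 1/2
        * S [1] [] [2] - 3/4 * S [1] [-1] []
  case' scalar_s00_u0_pow4 =>
    linear_combination (norm := skip) 1/6 * S [1] [-1] [-1] - 2 * S [1] [-1] [] + 1/12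
        * S [2] [-1] [-1] - 7/2 * S [-1] [] []
  case' scalar_u0_pow6 =>
    linear_combination (norm := skip) S [1] [] []
  case' vector_U0_u4 =>
    linear_combination (norm := skip) -V [0, 0, 0, 0, -1] [1] []
  case' vector_U1_u3 =>
    linear_combination (norm := skip) -V [0, 0, 0, 2] [0, -1] [0, 1] +
        V [0, 0, 0, 1] [0, -1] [0, 1]
  case' vector_U2_u2 =>
    linear_combination (norm := skip) -V [0, 0, -1] [0, 0, 1] []
  case' vector_U3_u1 =>
    linear_combination (norm := skip) -1/2 * V [0, 2] [0, 0, 0, -1] []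
  case' vector_U0_s03 =>
    linear_combination (norm := skip) V [] [-1, 0, 0, 1] []
  case' vector_U0_s12 =>
    linear_combination (norm := skip) -1/4 * V [] [-1, 0, 1] [0, 2, 2]
  case' vector_U0_u0_u3 =>
    linear_combination (norm := skip) V [1, 0, 0, 2] [1] [] + V [-1, 0, 0, 1] [1] []
  case' vector_U0_u1_u2 =>
    linear_combination (norm := skip) -V [0, 2, -1] [1] [] + V [0, 1, -1] [1] []
  case' vector_U1_s02 =>
    linear_combination (norm := skip) -V [] [0, 1] [1, 1, -1] + V [] [0, 1] [-1, -1]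
  case' vector_U1_s11 =>
    linear_combination (norm := skip) V [] [0, 1] []
  case' vector_U1_u0_u2 =>
    linear_combination (norm := skip) -V [1, 0, 1] [0, 1] [0, 2] - V [1, 0, 2] [0, -1] [0, 2]
  case' vector_U1_u1_pow2 =>
    linear_combination (norm := skip) -1/2 * V [0, 2] [0, -1] [0, -1] + V [0, 1] [0, -1] []
  case' vector_U2_s01 =>
    linear_combination (norm := skip) -1/2 * V [] [0, 0, -1] [1, 2]
  case' vector_U2_u0_u1 =>
    linear_combination (norm := skip) -V [-1, 1] [0, 0, -1] [] + V [-1, 2] [0, 0, -1] []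
  case' vector_U0_s00_u2 =>
    linear_combination (norm := skip) V [0, 0, -1] [-1] []
  case' vector_U0_s01_u1 =>
    linear_combination (norm := skip) -V [0, 2] [1] [1, -1] - V [0, 1] [1] [-1, -1]
  case' vector_U0_s02_u0 =>
    linear_combination (norm := skip) V [1] [-1] [-1, 0, 1] - V [-1] [1] [-1]
  case' vector_U0_s11_u0 =>
    linear_combination (norm := skip) V [1] [1] [0, 1] - V [1] [1] []
  case' vector_U0_u0_pow2_u2 =>
    linear_combination (norm := skip) -V [-1, 0, -1] [1] [-1] + 2 * V [-1, 0, 2] [1] [] - 2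
        * V [1, 0, -1] [-1] [] - V [1, 0, 2] [1] [1]
  case' vector_U0_u0_u1_pow2 =>
    linear_combination (norm := skip) 1/2 * V [-1, 1] [1] [2] - 1/3 * V [-1, 2] [1] [2] + 1/6
        * V [-1, -1] [-1] [2]
  case' vector_U1_s00_u1 =>
    linear_combination (norm := skip) 1/2 * V [0, -1] [0, -1] [1, 2] - 1/2
        * V [0, 1] [0, -1] [-1, 2]
  case' vector_U1_s01_u0 =>
    linear_combination (norm := skip) -1/2 * V [1] [0, -1] [1, 1] - 1/2 * V [1] [0, 1] [1, -1]
  case' vector_U1_u0_pow2_u1 =>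
    linear_combination (norm := skip) -1/2 * V [1, 1] [0, -1] [0, -1] - 1/2
        * V [1, -1] [0, 1] [0, 1]
  case' vector_U2_s00_u0 =>
    linear_combination (norm := skip) V [1] [0, 0, 1] [-1] - V [1] [0, 0, 1] []
  case' vector_U2_u0_pow3 =>
    linear_combination (norm := skip) -1/8 * V [2] [0, 0, -1] []
  case' vector_U0_s00_s01 =>
    linear_combination (norm := skip) 1/2 * V [] [1] [1, 1]
  case' vector_U0_s00_u0_u1 =>
    linear_combination (norm := skip) -V [-1, 1] [1] [] - V [1, 2] [-1] [1] - V [-1, 1] [-1] [-1]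
        + V [1, 2] [-1] []
  case' vector_U0_s01_u0_pow2 =>
    linear_combination (norm := skip) 1/6 * V [1] [1] [-1, 2] + 1/3 * V [2] [1] [-1] + 1/6
        * V [-1] [1] [-1] - 1/3 * V [2] [1] [1, -1]
  case' vector_U0_u0_pow3_u1 =>
    linear_combination (norm := skip) -1/2 * V [-1, 1] [-1] [-1] + 1/2 * V [-1, -1] [-1] [1] +
        V [-1, -1] [1] [] - V [-1, 1] [1] []
  case' vector_U1_s00_pow2 =>
    linear_combination (norm := skip) -V [] [0, -1] [-1, -1] + V [] [0, -1] [0, 1]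
  case' vector_U1_s00_u0_pow2 =>
    linear_combination (norm := skip) 4/3 * V [1] [0, 1] [-1] - 5/4 * V [-1] [0, 1] [] + 1/12
        * V [1] [0, -1] [2]
  case' vector_U1_u0_pow4 =>
    linear_combination (norm := skip) -V [1] [0, 1] [0, -1] - 2 * V [-1] [0, -1] []
  case' vector_U0_s00_pow2_u0 =>
    linear_combination (norm := skip) 1/6 * V [2] [-1] [2] + 4/3 * V [1] [1] [1] - 4
        * V [1] [-1] []
  case' vector_U0_s00_u0_pow3 =>
    linear_combination (norm := skip) -V [1] [1] [1] - 1/8 * V [2] [1] [1] - 5 * V [1] [-1] []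
  case' vector_U0_u0_pow5 =>
    linear_combination (norm := skip) 1/12 * V [2] [1] [1] - 1/3 * V [1] [-1] [-1] + 2
        * V [1] [-1] []
  all_goals
    simp only [listJet, List.getD_cons_zero, List.getD_cons_succ, List.getD_nil, mul_zero,
      zero_mul, add_zero, zero_add]
    ring1

/-! ### Exclusion of the cubic terms in the scalar equation -/

theorem SymmetryRelations.a3_eq_zero {a b : ℕ → ℂ} (h : SymmetryRelations a b)
    (ha : IsCoupledSecondOrder a) (hb : b 1 ≠ 0 ∨ b 12 ≠ 0) : a 3 = 0 := by
  obtain ⟨-, -, h7⟩ := ha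
  -- If `a 3 ≠ 0`, the pure `u` relations kill `b 1`, ..., `b 5`, so `b 12 ≠ 0`. The vector
  -- relations then kill `b 13`, `b 15`, `b 16`, `b 17`, `b 20`, and with them `a 7`, `a 8`, `a 9`,
  -- against the coupling.
  by_contra h3
  have := h.scalar_u0_pow3_u2
  have := h.scalar_u0_pow6
  have := h.scalar_u0_pow2_u1_pow2
  have := h.scalar_u0_u1_u2
  have := h.scalar_u1_pow3
  have := h.scalar_u0_pow4_u1
  have := h.vector_U0_u4
  have := h.vector_U2_u2
  have := h.vector_U3_u1
  have := h.vector_U0_u0_u3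
  have := h.vector_U0_u0_pow2_u2
  have := h.vector_U0_u0_u1_pow2
  have := h.vector_U2_u0_pow3
  have := h.vector_U0_u0_pow3_u1
  have := h.vector_U1_u0_pow4
  have := h.vector_U0_u0_pow5
  grind

/-- A nonzero `a 4` is incompatible with a nonzero leading coefficient `b 12`. -/
theorem SymmetryRelations.b12_eq_zero {a b : ℕ → ℂ} (h : SymmetryRelations a b)
    (ha : IsCoupledSecondOrder a) (h3 : a 3 = 0) (h4 : a 4 ≠ 0) : b 12 = 0 := by
  obtain ⟨h0, -, h7⟩ := ha
  by_contra hb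
  cases h
  -- The monomial `vector_U2_s00_u0` has coefficient `-a 4 * b 15`, and `vector_U3_u1` then gives `a
  -- 8 * b 12 = 0`. If moreover `a 6 = 0`, then `vector_U2_u2` and `vector_U2_u0_u1` leave `a 7 = a
  -- 9 = 0`.
  have hb15 : b 15 = 0 := by grind
  have h8 : a 8 = 0 := by grind
  rcases eq_or_ne (a 6) 0 with h6 | h6
  · grind
  · rcases eq_or_ne (a 1) 0 with h1 | h1 <;> grind

theorem SymmetryRelations.a4_eq_zero {a b : ℕ → ℂ} (h : SymmetryRelations a b)
    (ha : IsCoupledSecondOrder a) (hb : b 1 ≠ 0 ∨ b 12 ≠ 0) (h3 : a 3 = 0) : a 4 = 0 := by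
  by_contra h4
  have hb12 := h.b12_eq_zero ha h3 h4
  obtain ⟨h0, -, h7⟩ := ha
  cases h
  have hb15 : b 15 = 0 := by grind
  rcases eq_or_ne (a 6) 0 with h6 | h6
  · rcases eq_or_ne (a 8) 0 with h8 | h8
    · grind
    · rcases eq_or_ne (b 18) 0 with h18 | h18
      · grind
      · rcases eq_or_ne (a 5) 0 with h5 | h5
        · grind
        · rcases eq_or_ne (b 19) 0 with h19 | h19 <;> grind
  · rcases eq_or_ne (a 8) 0 with h8 | h8
    · grind
    -- The branch `a 5 ≠ 0` is empty: for `b 12 = 0`, the relations `scalar_s04`, `scalar_s13`,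
    -- `scalar_s22` are homogeneous in `b 8`, `b 9`, `a 5 * b 1` with determinant `-4 * a 6 ^ 2`.
    · rcases eq_or_ne (a 5) 0 with h5 | h5
      · rcases eq_or_ne (a 1) 0 with h1 | h1 <;> grind
      · grind

/-! ### The two regimes of the leading coefficients -/

/-- The coefficients of the first system, up to scaling. -/
theorem SymmetryRelations.of_b12_ne_zero {a b : ℕ → ℂ} (h : SymmetryRelations a b)
    (ha : IsCoupledSecondOrder a) (h3 : a 3 = 0) (h4 : a 4 = 0) (hb : b 12 ≠ 0) :
    a 6 ≠ 0 ∧ a 8 ≠ 0 ∧ a 2 * a 6 = 2 * a 1 * a 8 ∧ 2 * a 6 * a 7 = (a 6 - a 1) * a 8 ∧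
      4 * a 6 * a 9 = (4 * a 7 - a 8) * a 8 ∧ 4 * a 10 * a 6 = - a 5 * a 8 := by
  obtain ⟨h0, h5, h7⟩ := ha
  cases h
  have h5 : a 5 ≠ 0 := by grind
  have h6 : a 6 ≠ 0 := by grind
  -- All relations are linear in `b`, so a symmetry is known at best up to a factor; `c` is that
  -- factor.
  obtain ⟨c, hc⟩ : ∃ c, b 12 = c * a 6 := ⟨b 12 / a 6, by field_simp⟩
  have hc0 : c ≠ 0 := by grind
  have g1 : 2 * b 1 = c * (3 * a 1 - a 6) := by grind
  have g15 : 2 * b 15 = 3 * c * a 8 := by grind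
  have g8 : 2 * b 8 = 3 * c * a 5 := by grind
  have g9 : 2 * b 9 = 3 * c * a 5 := by grind
  have g13 : 2 * b 13 = 3 * c * a 7 := by grind
  -- `vector_U0_s12` and `vector_U1_s02` give `2 * b 14 = 3 * c * a 8`, which turns `vector_U2_u2`
  -- into `k7`. As `b 8 = b 9`, comparing `vector_U1_s11` with `vector_U1_s02` gives `b 18 = 0`, and
  -- `vector_U2_s01` becomes `k10`.
  have k7 : 2 * a 6 * a 7 = (a 6 - a 1) * a 8 := by
    rcases eq_or_ne (a 1) 0 with h1 | h1 <;> grind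
  have k10 : 4 * a 10 * a 6 = - a 5 * a 8 := by
    rcases eq_or_ne (a 1) 0 with h1 | h1 <;> grind
  have k9 : 4 * a 6 * a 9 = (4 * a 7 - a 8) * a 8 := by
    rcases eq_or_ne (a 1) 0 with h1 | h1 <;> grind
  have k2 : a 2 * a 6 = 2 * a 1 * a 8 := by
    rcases eq_or_ne (a 1) 0 with h1 | h1 <;> grind
  exact ⟨h6, by grind, k2, k7, k9, k10⟩

/-- The coefficients of the second and the third system, up to scaling. -/
theorem SymmetryRelations.of_b12_eq_zero {a b : ℕ → ℂ} (h : SymmetryRelations a b)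
    (ha : IsCoupledSecondOrder a) (h3 : a 3 = 0) (h4 : a 4 = 0) (hb1 : b 1 ≠ 0)
    (hb : b 12 = 0) :
    a 1 ≠ 0 ∧ a 6 = 0 ∧ a 2 ≠ 0 ∧
      ((a 8 = 0 ∧ 4 * a 7 = - a 2 ∧ 8 * a 1 * a 9 = - a 2 ^ 2 ∧ 8 * a 1 * a 10 = - a 5 * a 2) ∨
        (a 2 = 2 * a 8 ∧ 4 * a 7 = a 2 ∧ a 9 = 0 ∧ a 10 = 0)) := by
  obtain ⟨h0, h5, h7⟩ := ha
  cases h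
  have h5 : a 5 ≠ 0 := by grind
  -- For `b 12 = 0` the system for `b 8`, `b 9`, `a 5 * b 1` is homogeneous. Since `a 5 * b 1 ≠ 0`,
  -- its determinant `-4 * a 6 ^ 2` vanishes, so `a 6 = 0` and hence `a 1 ≠ 0`.
  have h1 : a 1 ≠ 0 := by grind
  have h6 : a 6 = 0 := by grind
  have h2 : a 2 ≠ 0 := by
    rcases eq_or_ne (a 8) 0 with h8 | h8 <;> grind
  obtain ⟨c, hc⟩ : ∃ c, b 1 = c * a 1 := ⟨b 1 / a 1, by field_simp⟩
  have hc0 : c ≠ 0 := by grind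
  have g8 : b 8 = c * a 5 := by grind
  have g9 : b 9 = c * a 5 := by grind
  have g2 : 2 * b 2 = 3 * c * a 2 := by grind
  have g3 : b 3 = b 2 := by grind
  have g13 : b 13 = c * a 7 := by grind
  have g14 : b 14 = c * a 8 := by grind
  have g15 : b 15 = 0 := by grind
  -- Eliminating `b 6` and `b 7` from `scalar_s01_u2`, `scalar_s02_u1`, `scalar_s03_u0` gives `k7`.
  -- The dichotomy `k8` is `vector_U1_u1_pow2`, and `k9` is the difference of `vector_U0_u0_u3` and
  -- `vector_U0_u1_u2`.
  have k7 : 4 * a 7 = 4 * a 8 - a 2 := by grind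
  have k8 : a 8 * (a 2 - 2 * a 8) = 0 := by grind
  have k9 : 2 * a 1 * a 9 = a 7 * (a 2 - 2 * a 8) := by grind
  refine ⟨h1, h6, h2, ?_⟩
  rcases eq_or_ne (a 8) 0 with h8 | h8
  · have h7' : a 7 ≠ 0 := by grind
    -- Here `vector_U1_s00_u1` reduces to `a 7 * b 18 = 0`.
    have g18 : b 18 = 0 := by grind
    have g19 : 4 * a 1 * b 19 = - c * a 5 * a 2 := by grind
    have g6 : 4 * a 1 * b 6 = c * a 5 * a 2 := by grind
    have k10 : 8 * a 1 * a 10 = - a 5 * a 2 := by grind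
    exact Or.inl ⟨h8, by grind, by grind, k10⟩
  · have k2 : a 2 = 2 * a 8 := by grind
    have k9' : a 9 = 0 := by grind
    have k10 : a 10 = 0 := by grind
    exact Or.inr ⟨k2, by grind, k9', k10⟩

/-! ### Normalization by scalings -/

theorem exists_algHom_rescale (α γ δ : ℂ) : ∃ φ : DiffPoly N →ₐ[ℂ] DiffPoly N,
    (∀ n, φ (uD n) = C (1 / γ) * uD n) ∧ (∀ j n, φ (vD j n) = C (1 / δ) * vD j n) ∧
      ∀ F c, rescale α 1 γ δ F c = C (scaleFactor γ δ c / α) * φ (F c) :=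
  ⟨aeval fun v => C (1 ^ v.2 / scaleFactor γ δ v.1) * X v, by simp [uD, scaleFactor],
    by simp [vD, scaleFactor], fun _ _ => rfl⟩

/-- The system `generalSystem2 N a` coincides with `G` up to scaling if `G` has the coefficients
that `a` gets from the scaling of `t`, `u`, `U` by `α`, `γ`, `δ`. -/
theorem coincideUpToScaling_of_eq {a : ℕ → ℂ} {G : EvolSystem N} (α γ δ : ℂ) (hα : α ≠ 0)
    (hγ : γ ≠ 0) (hδ : δ ≠ 0) (h3 : a 3 = 0) (h4 : a 4 = 0)
    (hu : G none = C (a 1 / α) * uD 2 + C (a 2 / (α * γ)) * uD 0 * uD 1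
      + C (a 5 * γ / (α * δ ^ 2)) * sProd 0 1)
    (hU : ∀ j, G (some j) = C (a 6 / α) * vD j 2 + C (a 7 / (α * γ)) * uD 1 * vD j 0
      + C (a 8 / (α * γ)) * uD 0 * vD j 1 + C (a 9 / (α * γ ^ 2)) * uD 0 ^ 2 * vD j 0
      + C (a 10 / (α * δ ^ 2)) * sProd 0 0 * vD j 0) :
    CoincideUpToScaling (generalSystem2 N a) G := by
  -- Nothing is lost with `β = 1`: by homogeneity, the scaling with `α = β ^ 2` and `γ = δ = β⁻¹`
  -- fixes the system.
  refine ⟨α, 1, γ, δ, hα, one_ne_zero, hγ, hδ, ?_⟩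
  obtain ⟨φ, hφu, hφv, hφ⟩ := exists_algHom_rescale (N := N) α γ δ
  have hs (m n : ℕ) : φ (sProd m n) = C (1 / δ) * C (1 / δ) * sProd m n := by
    simp only [sProd, map_sum, map_mul, hφv, Finset.mul_sum]
    exact Finset.sum_congr rfl fun j _ => by ring
  have hC (c : ℂ) : φ (C c) = C c := φ.commutes c
  funext c
  rw [hφ]
  cases c with
  | none =>
    -- The coefficients are factored as the substitution produces them, since `ring` treats `C (1 /
    -- γ)` and the like as atoms.
    have e1 : a 1 / α = γ / α * a 1 * (1 / γ) := by field_simp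
    have e2 : a 2 / (α * γ) = γ / α * a 2 * (1 / γ) * (1 / γ) := by field_simp
    have e5 : a 5 * γ / (α * δ ^ 2) = γ / α * a 5 * (1 / δ) * (1 / δ) := by field_simp
    rw [hu, e1, e2, e5]
    simp only [generalSystem2, map_add, map_mul, map_pow, hs, hC, hφu, scaleFactor, h3, h4,
      map_zero]
    ring
  | some j =>
    have e6 : a 6 / α = δ / α * a 6 * (1 / δ) := by field_simp
    have e7 : a 7 / (α * γ) = δ / α * a 7 * (1 / γ) * (1 / δ) := by field_simp
    have e8 : a 8 / (α * γ) = δ / α * a 8 * (1 / γ) * (1 / δ) := by field_simp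
    have e9 : a 9 / (α * γ ^ 2) = δ / α * a 9 * (1 / γ) * (1 / γ) * (1 / δ) := by field_simp
    have e10 : a 10 / (α * δ ^ 2) = δ / α * a 10 * (1 / δ) * (1 / δ) * (1 / δ) := by field_simp
    rw [hU, e6, e7, e8, e9, e10]
    simp only [generalSystem2, map_add, map_mul, map_pow, hs, hC, hφu, hφv, scaleFactor]
    ring

theorem coincide_burgersSystem1 {a : ℕ → ℂ} (h3 : a 3 = 0) (h4 : a 4 = 0) (h5 : a 5 ≠ 0)
    (h6 : a 6 ≠ 0) (h8 : a 8 ≠ 0) (h2 : a 2 * a 6 = 2 * a 1 * a 8)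
    (h7 : 2 * a 6 * a 7 = (a 6 - a 1) * a 8) (h9 : 4 * a 6 * a 9 = (4 * a 7 - a 8) * a 8)
    (h10 : 4 * a 10 * a 6 = - a 5 * a 8) :
    ∃ p, CoincideUpToScaling (generalSystem2 N a) (burgersSystem1 N p) := by
  -- With `α = a 6` and `γ = a 8 / a 6`, the coefficients of `U_xx` and `u U_x` become 1; this `δ ^
  -- 2` makes that of `⟨U,U_x⟩` equal to 4/3.
  obtain ⟨δ, hδ⟩ :=
    IsAlgClosed.exists_pow_nat_eq (3 * a 5 * a 8 / (4 * a 6 ^ 2)) zero_lt_two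
  have hδ0 : δ ≠ 0 := by
    rintro rfl
    simpa [h5, h6, h8] using hδ.symm
  have e9 : a 9 = (a 6 - 2 * a 1) * a 8 ^ 2 / (4 * a 6 ^ 2) := by
    field_simp
    linear_combination a 6 * h9 + 2 * a 8 * h7
  have e7 : a 7 = (a 6 - a 1) * a 8 / (2 * a 6) := by
    field_simp
    linear_combination h7
  have e2 : a 2 = 2 * a 1 * a 8 / a 6 := by
    field_simp
    linear_combination h2
  have e10 : a 10 = - a 5 * a 8 / (4 * a 6) := by
    field_simp
    linear_combination h10
  -- The parameter solves `(1 + 2 * p) / 3 = a 1 / a 6`.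
  refine ⟨(3 * a 1 / a 6 - 1) / 2, coincideUpToScaling_of_eq (a 6) (a 8 / a 6) δ h6
    (div_ne_zero h8 h6) hδ0 h3 h4 ?_ fun j => ?_⟩
  · have c1 : a 1 / a 6 = 1 / 3 * (1 + 2 * ((3 * a 1 / a 6 - 1) / 2)) := by ring
    have c2 : a 2 / (a 6 * (a 8 / a 6)) =
        1 / 3 * (1 + 2 * ((3 * a 1 / a 6 - 1) / 2)) * 2 := by
      rw [e2]; field_simp; ring
    have c5 : a 5 * (a 8 / a 6) / (a 6 * δ ^ 2) = 4 / 3 := by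
      rw [hδ]; field_simp
    rw [c1, c2, c5, map_mul _ _ (2 : ℂ), map_ofNat]
    simp only [burgersSystem1]
    ring
  · have c6 : a 6 / a 6 = 1 := div_self h6
    have c7 : a 7 / (a 6 * (a 8 / a 6)) = 1 / 3 * (1 - (3 * a 1 / a 6 - 1) / 2) := by
      rw [e7]; field_simp; ring
    have c8 : a 8 / (a 6 * (a 8 / a 6)) = 1 := by field_simp
    have c9 : a 9 / (a 6 * (a 8 / a 6) ^ 2) =
        1 / 12 * (1 - 4 * ((3 * a 1 / a 6 - 1) / 2)) := by
      rw [e9]; field_simp; ring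
    have c10 : a 10 / (a 6 * δ ^ 2) = - (1 / 3) := by
      rw [hδ, e10]; field_simp
    rw [c6, c7, c8, c9, c10, map_neg, map_one]
    simp only [burgersSystem1]
    ring

theorem coincide_burgersSystem2 {a : ℕ → ℂ} (h3 : a 3 = 0) (h4 : a 4 = 0) (h5 : a 5 ≠ 0)
    (h1 : a 1 ≠ 0) (h6 : a 6 = 0) (h2 : a 2 ≠ 0) (h8 : a 8 = 0) (h7 : 4 * a 7 = - a 2)
    (h9 : 8 * a 1 * a 9 = - a 2 ^ 2) (h10 : 8 * a 1 * a 10 = - a 5 * a 2) :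
    CoincideUpToScaling (generalSystem2 N a) (burgersSystem2 N) := by
  -- With `α = a 1` and `γ = a 2 / (2 * a 1)`, the coefficients of `u_xx` and `u u_x` become 1 and
  -- 2; `δ` makes that of `⟨U,U_x⟩` equal to 2.
  obtain ⟨δ, hδ⟩ :=
    IsAlgClosed.exists_pow_nat_eq (a 5 * a 2 / (4 * a 1 ^ 2)) zero_lt_two
  have hδ0 : δ ≠ 0 := by
    rintro rfl
    simpa [h5, h1, h2] using hδ.symm
  have hγ : a 2 / (2 * a 1) ≠ 0 := div_ne_zero h2 (mul_ne_zero two_ne_zero h1)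
  have e7 : a 7 = - a 2 / 4 := by linear_combination h7 / 4
  have e9 : a 9 = - a 2 ^ 2 / (8 * a 1) := by
    field_simp
    linear_combination h9
  have e10 : a 10 = - a 5 * a 2 / (8 * a 1) := by
    field_simp
    linear_combination h10
  refine coincideUpToScaling_of_eq (a 1) (a 2 / (2 * a 1)) δ h1 hγ hδ0 h3 h4 ?_ fun j => ?_
  · have c2 : a 2 / (a 1 * (a 2 / (2 * a 1))) = 2 := by field_simp
    have c5 : a 5 * (a 2 / (2 * a 1)) / (a 1 * δ ^ 2) = 2 := by
      rw [hδ]; field_simp; norm_num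
    rw [div_self h1, c2, c5, map_one, map_ofNat]
    simp only [burgersSystem2]
    ring
  · have c7 : a 7 / (a 1 * (a 2 / (2 * a 1))) = - (1 / 2) := by
      rw [e7]; field_simp; norm_num
    have c9 : a 9 / (a 1 * (a 2 / (2 * a 1)) ^ 2) = - (1 / 2) := by
      rw [e9]; field_simp; norm_num
    have c10 : a 10 / (a 1 * δ ^ 2) = - (1 / 2) := by
      rw [hδ, e10]; field_simp; norm_num
    rw [h6, h8, c7, c9, c10, zero_div, zero_div, map_neg, map_zero]
    simp only [burgersSystem2]
    ring

theorem coincide_burgersSystem3 {a : ℕ → ℂ} (h3 : a 3 = 0) (h4 : a 4 = 0) (h5 : a 5 ≠ 0)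
    (h1 : a 1 ≠ 0) (h6 : a 6 = 0) (h2 : a 2 ≠ 0) (h8 : a 2 = 2 * a 8) (h7 : 4 * a 7 = a 2)
    (h9 : a 9 = 0) (h10 : a 10 = 0) :
    CoincideUpToScaling (generalSystem2 N a) (burgersSystem3 N) := by
  -- Same `α` and `γ` as for the second system; the doubled `δ ^ 2` makes the coefficient of
  -- `⟨U,U_x⟩` equal to 1.
  obtain ⟨δ, hδ⟩ :=
    IsAlgClosed.exists_pow_nat_eq (a 5 * a 2 / (2 * a 1 ^ 2)) zero_lt_two
  have hδ0 : δ ≠ 0 := by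
    rintro rfl
    simpa [h5, h1, h2] using hδ.symm
  have hγ : a 2 / (2 * a 1) ≠ 0 := div_ne_zero h2 (mul_ne_zero two_ne_zero h1)
  have e7 : a 7 = a 2 / 4 := by linear_combination h7 / 4
  have e8 : a 8 = a 2 / 2 := by linear_combination - h8 / 2
  refine coincideUpToScaling_of_eq (a 1) (a 2 / (2 * a 1)) δ h1 hγ hδ0 h3 h4 ?_ fun j => ?_
  · have c2 : a 2 / (a 1 * (a 2 / (2 * a 1))) = 2 := by field_simp
    have c5 : a 5 * (a 2 / (2 * a 1)) / (a 1 * δ ^ 2) = 1 := by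
      rw [hδ]; field_simp
    rw [div_self h1, c2, c5, map_one, map_ofNat]
    simp only [burgersSystem3]
    ring
  · have c7 : a 7 / (a 1 * (a 2 / (2 * a 1))) = 1 / 2 := by
      rw [e7]; field_simp; norm_num
    have c8 : a 8 / (a 1 * (a 2 / (2 * a 1))) = 1 := by
      rw [e8]; field_simp
    rw [h6, h9, h10, c7, c8, zero_div, zero_div, zero_div, map_one, map_zero]
    simp only [burgersSystem3]
    ring

end

/-! ### The classification -/

theorem mainTheorem2 (N : ℕ) (hN : 2 ≤ N) (a : ℕ → ℂ) (ha : IsCoupledSecondOrder a)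
    (hsym : ∃ b : ℕ → ℂ, IsThirdOrder b ∧
      IsSymmetry (generalSystem2 N a) (generalSystem3 N b)) :
    (∃ p : ℂ, CoincideUpToScaling (generalSystem2 N a) (burgersSystem1 N p)) ∨
      CoincideUpToScaling (generalSystem2 N a) (burgersSystem2 N) ∨
      CoincideUpToScaling (generalSystem2 N a) (burgersSystem3 N) := by
  obtain ⟨b, ⟨hb, -, -⟩, hsym⟩ := hsym
  have h := symmetryRelations hN hsym
  have h3 := h.a3_eq_zero ha hb
  have h4 := h.a4_eq_zero ha hb h3
  have h5 : a 5 ≠ 0 := ha.2.1.resolve_left (not_not.2 h4)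
  rcases eq_or_ne (b 12) 0 with hb12 | hb12
  · obtain ⟨h1, h6, h2, ⟨h8, h7, h9, h10⟩ | ⟨h8, h7, h9, h10⟩⟩ :=
      h.of_b12_eq_zero ha h3 h4 (hb.resolve_right (not_not.2 hb12)) hb12
    · exact Or.inr (Or.inl (coincide_burgersSystem2 h3 h4 h5 h1 h6 h2 h8 h7 h9 h10))
    · exact Or.inr (Or.inr (coincide_burgersSystem3 h3 h4 h5 h1 h6 h2 h8 h7 h9 h10))
  · obtain ⟨h6, h8, h2, h7, h9, h10⟩ := h.of_b12_ne_zero ha h3 h4 hb12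
    exact Or.inl (coincide_burgersSystem1 h3 h4 h5 h6 h8 h2 h7 h9 h10)
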